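/- Let $1 \to A \to G \xrightarrow{q} Q \to 1$ be an extension of (finite-dimensional real) Lie groups such that $A \cong \mathbb{R}$. For a Lie group $H$ with left Haar measure $\lambda_H$, let $C_c(H)$ denote the algebra of compactly supported continuous functions $H \to \mathbb{C}$ with the convolution product $$(f*g)(x) = \int_H f(y)\, g(y^{-1}x)\, d\lambda_H(y).$$ If $C_c(Q)$ has no zero divisors (that is, $f*g=0$ with $f,g\in C_c(Q)$ implies $f=0$ or $g=0$), then $C_c(G)$ has no zero divisors either. -/

import Mathlib

open MeasureTheory
open scoped Manifold ContDiff CompactlySupported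

/-- The convolution `(f * g)(x) = ∫ f(y) g(y⁻¹ x) dμ(y)` on a group with a measure `μ`
(a left Haar measure in the intended use). -/
noncomputable def groupConvolution {G : Type*} [Group G] [MeasurableSpace G] (μ : Measure G)
    (f g : G → ℂ) : G → ℂ :=
  fun x => ∫ y, f y * g (y⁻¹ * x) ∂μ

/-- The convolution algebra `C_c(G)` of compactly supported continuous complex-valued functions,
with the convolution taken with respect to `μ`, has no zero divisors: if `f * g = 0`
then `f = 0` or `g = 0`. -/
def CcHasNoZeroDivisors (G : Type*) [Group G] [TopologicalSpace G] [MeasurableSpace G]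
    (μ : Measure G) : Prop :=
  ∀ f g : C_c(G, ℂ), groupConvolution μ f g = 0 → f = 0 ∨ g = 0

/-- A short exact sequence of groups `1 → A → G → Q → 1` (Mathlib's `GroupExtension`) between
finite-dimensional real Lie groups is an extension of Lie groups if both homomorphisms are smooth,
`A` carries the topology of its image in `G`, and `Q` carries the quotient topology. Since Lie
groups in Mathlib may have uncountably many components, the topological conditions
have to be spelled out; they are automatic for second countable groups. -/
structure IsLieGroupExtension (EA EG EQ : Type*)
    [NormedAddCommGroup EA] [NormedSpace ℝ EA]
    [NormedAddCommGroup EG] [NormedSpace ℝ EG]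
    [NormedAddCommGroup EQ] [NormedSpace ℝ EQ]
    {A G Q : Type*}
    [Group A] [TopologicalSpace A] [ChartedSpace EA A]
    [Group G] [TopologicalSpace G] [ChartedSpace EG G]
    [Group Q] [TopologicalSpace Q] [ChartedSpace EQ Q]
    (S : GroupExtension A G Q) : Prop where
  contMDiff_inl : ContMDiff 𝓘(ℝ, EA) 𝓘(ℝ, EG) ∞ S.inl
  contMDiff_rightHom : ContMDiff 𝓘(ℝ, EG) 𝓘(ℝ, EQ) ∞ S.rightHom
  isEmbedding_inl : Topology.IsEmbedding S.inl
  isQuotientMap_rightHom : Topology.IsQuotientMap S.rightHom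

/-! Suppose `f * g = 0` with `f`, `g` nonzero. Integrating over fibres turns convolution on `G` into
convolution on `Q`, so the only obstruction is that fibre integrals may vanish. The left annihilator
of `g` is stable under translation by `A` on the left. If all orbit integrals of its members were
zero, primitives along orbits would stay compactly supported and stay in it; integrating by parts,
all moments of `f` along each orbit would vanish, and Weierstrass approximation would force `f = 0`
(`Flow.IsProperFlow.eq_zero_of_forall_orbitIntegral_eq_zero`). Hence some `F` with `F * g = 0` has a
nonzero orbit integral, and likewise on the right some `K` with `F * K = 0`. Normality of `A`
identifies left and right orbits up to scaling, so the images of `F` and `K` are zero divisors in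
`C_c(Q)`. -/

/-! ### Moments of compactly supported functions. -/

/-- A continuous compactly supported real function all of whose moments vanish is zero. -/
theorem eq_zero_of_forall_integral_pow_mul_eq_zero_real {u : ℝ → ℝ} (hc : Continuous u)
    (hs : HasCompactSupport u) (hm : ∀ n : ℕ, ∫ t, t ^ n * u t = 0) : u = 0 := by
  have hint {v : ℝ → ℝ} (hv : Continuous v) : Integrable fun t => v t * u t :=
    (hv.mul hc).integrable_of_hasCompactSupport hs.mul_left
  have hpoly (p : Polynomial ℝ) : ∫ t, p.eval t * u t = 0 := by
    simp_rw [Polynomial.eval_eq_sum_range, Finset.sum_mul, mul_assoc]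
    rw [integral_finsetSum _ fun n _ => (hint (continuous_pow n)).const_mul _]
    simp [integral_const_mul, hm]
  obtain ⟨R, hR⟩ := hs.isCompact.isBounded.subset_closedBall 0
  rw [Real.closedBall_eq_Icc] at hR
  have hsq : ∫ t, u t * u t = 0 := by
    refine le_antisymm (le_of_forall_pos_le_add fun δ hδ => ?_)
      (integral_nonneg fun t => mul_self_nonneg _)
    have hN : 0 ≤ ∫ t, |u t| := integral_nonneg fun t => abs_nonneg _
    -- As `∫ p u = 0`, `∫ u²` equals `∫ (u - p) u`, which a small `|u - p|` on the support makes
    -- small. The `+ 1` guards against division by zero.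
    obtain ⟨p, hp⟩ := exists_polynomial_near_of_continuousOn _ _ u (hc.continuousOn (s := Set.Icc
      (0 - R) (0 + R))) (δ / ((∫ t, |u t|) + 1)) (by positivity)
    have hub : Integrable fun t => |u t| := (hc.integrable_of_hasCompactSupport hs).abs
    calc ∫ t, u t * u t = ∫ t, (u t * u t - p.eval t * u t) := by
          rw [integral_sub (hint hc) (hint p.continuous), hpoly, sub_zero]
      _ ≤ ∫ t, δ / ((∫ t, |u t|) + 1) * |u t| := by
          refine integral_mono ((hint hc).sub (hint p.continuous)) (hub.const_mul _) fun t => ?_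
          by_cases ht : t ∈ tsupport u
          · calc u t * u t - p.eval t * u t ≤ |(p.eval t - u t) * u t| := by
                  rw [← abs_neg]; refine le_trans (le_of_eq ?_) (le_abs_self _); ring
              _ ≤ _ := by
                  rw [abs_mul]
                  exact mul_le_mul_of_nonneg_right (hp t (hR ht)).le (abs_nonneg _)
          · simp [image_eq_zero_of_notMem_tsupport ht]
      _ ≤ 0 + δ := by
          rw [integral_const_mul, zero_add, div_mul_eq_mul_div, div_le_iff₀ (by positivity)]
          nlinarith
  have := (integral_eq_zero_iff_of_nonneg (fun t => mul_self_nonneg (u t)) (hint hc)).1 hsq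
  have := (hc.mul hc).ae_eq_iff_eq volume continuous_const |>.1 this
  funext t
  exact mul_self_eq_zero.1 (congrFun this t)

/-- A continuous compactly supported complex function on `ℝ` all of whose moments vanish is
zero. -/
theorem eq_zero_of_forall_integral_pow_mul_eq_zero {u : ℝ → ℂ} (hc : Continuous u)
    (hs : HasCompactSupport u) (hm : ∀ n : ℕ, ∫ t : ℝ, (t : ℂ) ^ n * u t = 0) : u = 0 := by
  have hint (n : ℕ) : Integrable fun t : ℝ => (t : ℂ) ^ n * u t :=
    (show Continuous fun t : ℝ => (t : ℂ) ^ n * u t by fun_prop).integrable_of_hasCompactSupport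
      hs.mul_left
  have hre : (fun t => (u t).re) = 0 := by
    refine eq_zero_of_forall_integral_pow_mul_eq_zero_real (Complex.continuous_re.comp hc)
      (hs.comp_left Complex.zero_re) fun n => ?_
    have := Complex.reCLM.integral_comp_comm (hint n)
    rw [hm, map_zero] at this
    simpa [← Complex.ofReal_pow] using this
  have him : (fun t => (u t).im) = 0 := by
    refine eq_zero_of_forall_integral_pow_mul_eq_zero_real (Complex.continuous_im.comp hc)
      (hs.comp_left Complex.zero_im) fun n => ?_
    have := Complex.imCLM.integral_comp_comm (hint n)
    rw [hm, map_zero] at this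
    simpa [← Complex.ofReal_pow] using this
  funext t
  exact Complex.ext (congrFun hre t) (congrFun him t)

/-! ### Proper flows, orbit integrals and primitives. -/

namespace Flow

variable {X : Type*} [TopologicalSpace X]

/-- A flow is proper if, for compact `K` and `L`, the times at which a point of `K` is in `L`
form a relatively compact set. -/
def IsProperFlow (φ : Flow ℝ X) : Prop :=
  ∀ K L : Set X, IsCompact K → IsCompact L →
    ∃ T : Set ℝ, IsCompact T ∧ ∀ x ∈ K, ∀ t, φ t x ∈ L → t ∈ T

/-- The integral of a function over an orbit of a flow. -/
noncomputable def orbitIntegral (φ : Flow ℝ X) (f : X → ℂ) (x : X) : ℂ := ∫ t, f (φ t x)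

/-- The integral of a function over the past of a point. -/
noncomputable def primitive (φ : Flow ℝ X) (f : X → ℂ) (x : X) : ℂ :=
  ∫ t in Set.Iic (0 : ℝ), f (φ t x)

variable {φ : Flow ℝ X}

theorem continuous_orbit (φ : Flow ℝ X) (x : X) : Continuous fun t => φ t x :=
  φ.continuous continuous_id continuous_const

theorem IsProperFlow.hasCompactSupport_orbit (hφ : φ.IsProperFlow) {f : X → ℂ}
    (hf : HasCompactSupport f) (x : X) : HasCompactSupport fun t => f (φ t x) := by
  obtain ⟨T, hT, h⟩ := hφ {x} (tsupport f) isCompact_singleton hf.isCompact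
  refine HasCompactSupport.intro hT fun t ht => ?_
  by_contra h0
  exact ht (h x rfl t (subset_tsupport f h0))

theorem IsProperFlow.integrable_orbit (hφ : φ.IsProperFlow) {f : X → ℂ} (hc : Continuous f)
    (hf : HasCompactSupport f) (x : X) : Integrable fun t => f (φ t x) :=
  (hc.comp (φ.continuous_orbit x)).integrable_of_hasCompactSupport
    (hφ.hasCompactSupport_orbit hf x)

theorem IsProperFlow.continuous_primitive [WeaklyLocallyCompactSpace X] (hφ : φ.IsProperFlow)
    {f : X → ℂ} (hc : Continuous f) (hf : HasCompactSupport f) : Continuous (φ.primitive f) := by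
  refine continuous_iff_continuousAt.2 fun x => ?_
  obtain ⟨K, hK, hxK⟩ := exists_compact_mem_nhds x
  obtain ⟨T, hT, h⟩ := hφ K (tsupport f) hK hf.isCompact
  refine ContinuousOn.continuousAt (s := K) ?_ hxK
  refine continuousOn_integral_of_compact_support (f := fun x t => f (φ t x)) hT ?_ ?_
  · exact (hc.comp (φ.continuous continuous_snd continuous_fst)).continuousOn
  · intro y t hy ht
    by_contra h0
    exact ht (h y hy t (subset_tsupport f h0))

theorem primitive_apply_flow (φ : Flow ℝ X) (f : X → ℂ) (s : ℝ) (x : X) :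
    φ.primitive f (φ s x) = ∫ t in Set.Iic s, f (φ t x) := by
  have h := (measurePreserving_add_right (volume : Measure ℝ) s).setIntegral_preimage_emb
    (MeasurableEquiv.addRight s).measurableEmbedding (fun t => f (φ t x)) (Set.Iic s)
  rw [← h, primitive]
  simp [map_add]

/-- Along an orbit, the primitive is zero before the support is entered and equals the full orbit
integral, again zero, after it is left. -/
theorem IsProperFlow.hasCompactSupport_primitive [R1Space X] (hφ : φ.IsProperFlow) {f : X → ℂ}
    (hf : HasCompactSupport f) (h0 : φ.orbitIntegral f = 0) :
    HasCompactSupport (φ.primitive f) := by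
  obtain ⟨T, hT, h⟩ := hφ _ _ hf.isCompact hf.isCompact
  obtain ⟨R, hR⟩ := hT.isBounded.subset_closedBall 0
  rw [Real.closedBall_eq_Icc, zero_sub, zero_add] at hR
  refine HasCompactSupport.intro (K := (fun p : ℝ × X => φ p.1 p.2) '' (Set.Icc (-R) R ×ˢ
    tsupport f)) ((isCompact_Icc.prod hf.isCompact).image
      (φ.continuous continuous_fst continuous_snd)) fun x hx => ?_
  by_contra hne
  have : ∃ t, f (φ t x) ≠ 0 := by
    by_contra! hall
    exact hne (by simp [primitive, hall])
  obtain ⟨t, ht⟩ := this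
  have hts : φ t x ∈ tsupport f := subset_tsupport f ht
  have hx' : φ (-t) (φ t x) = x := by rw [← map_add]; simp
  have htR : -t ∉ Set.Icc (-R) R := fun hmem => hx ⟨(-t, φ t x), ⟨hmem, hts⟩, hx'⟩
  have hsupp : ∀ s, f (φ s (φ t x)) ≠ 0 → s ∈ Set.Icc (-R) R := fun s hs =>
    hR (h _ hts s (subset_tsupport f hs))
  apply hne
  rw [← hx', primitive_apply_flow]
  by_cases hlt : -t < -R
  · refine setIntegral_eq_zero_of_forall_eq_zero fun s hs => ?_
    by_contra hs0
    exact absurd (hsupp s hs0).1 (not_le.2 (lt_of_le_of_lt hs hlt))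
  · rw [setIntegral_eq_integral_of_forall_compl_eq_zero]
    · exact congrFun h0 _
    · intro s hs
      by_contra hs0
      exact htR ⟨not_lt.1 hlt, (not_le.1 hs).le.trans (hsupp s hs0).2⟩

theorem IsProperFlow.hasDerivAt_primitive (hφ : φ.IsProperFlow) {f : X → ℂ} (hc : Continuous f)
    (hf : HasCompactSupport f) (x : X) (s : ℝ) :
    HasDerivAt (fun s => φ.primitive f (φ s x)) (f (φ s x)) s := by
  have hint := hφ.integrable_orbit hc hf x
  have hcont : Continuous fun t => f (φ t x) := hc.comp (φ.continuous_orbit x)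
  have h := (intervalIntegral.integral_hasDerivAt_right (hcont.intervalIntegrable 0 s)
    (hcont.stronglyMeasurableAtFilter _ _) hcont.continuousAt).const_add
      (∫ t in Set.Iic (0 : ℝ), f (φ t x))
  refine h.congr_of_eventuallyEq (Filter.Eventually.of_forall fun r => ?_)
  simp only [primitive_apply_flow]
  rw [← intervalIntegral.integral_Iic_sub_Iic hint.integrableOn hint.integrableOn]
  ring

/-- A class of compactly supported functions that is closed under primitives and whose members
all have vanishing orbit integrals contains only the zero function. -/
theorem IsProperFlow.eq_zero_of_forall_orbitIntegral_eq_zero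
    (hφ : φ.IsProperFlow) {P : (X → ℂ) → Prop}
    (hP : ∀ f, P f → Continuous f ∧ HasCompactSupport f ∧ φ.orbitIntegral f = 0 ∧
      P (φ.primitive f)) {f : X → ℂ} (hf : P f) : f = 0 := by
  -- The moment of order `n + 1` of `f` is `-(n + 1)` times that of order `n` of its primitive, so
  -- the induction must run over all members of `P` at once.
  have hmom (n : ℕ) : ∀ f, P f → ∀ x, ∫ t : ℝ, (t : ℂ) ^ n * f (φ t x) = 0 := by
    induction n with
    | zero =>
      intro f hf x
      simpa [orbitIntegral] using congrFun (hP f hf).2.2.1 x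
    | succ n ih =>
      intro f hf x
      obtain ⟨hc, hs, -, hp⟩ := hP f hf
      obtain ⟨hpc, hps, -, -⟩ := hP _ hp
      have hder (t : ℝ) : HasDerivAt (fun t : ℝ => (t : ℂ) ^ (n + 1))
          ((n + 1 : ℂ) * (t : ℂ) ^ n) t := by
        simpa using (hasDerivAt_pow (n + 1) (t : ℂ)).comp_ofReal
      have hint {v : ℝ → ℂ} (hv : Continuous v) {g : X → ℂ} (hg : Continuous g)
          (hgs : HasCompactSupport g) : Integrable (v * fun t => g (φ t x)) :=
        (hv.mul (hg.comp (φ.continuous_orbit x))).integrable_of_hasCompactSupport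
          (hφ.hasCompactSupport_orbit hgs x).mul_left
      rw [integral_mul_deriv_eq_deriv_mul_of_integrable
        (u' := fun t : ℝ => (n + 1 : ℂ) * (t : ℂ) ^ n)
        (v := fun t => φ.primitive f (φ t x)) (fun t _ => hder t)
        (fun t _ => hφ.hasDerivAt_primitive hc hs x t) (hint (by fun_prop) hc hs)
        (hint (by fun_prop) hpc hps) (hint (by fun_prop) hpc hps)]
      simp_rw [mul_assoc, integral_const_mul, ih _ hp x]
      simp
  funext x
  obtain ⟨hc, hs, -⟩ := hP f hf
  have := eq_zero_of_forall_integral_pow_mul_eq_zero (hc.comp (φ.continuous_orbit x))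
    (hφ.hasCompactSupport_orbit hs x) fun n => hmom n f hf x
  simpa [map_zero_apply] using congrFun this 0

end Flow

/-! ### Translations by a closed one-parameter subgroup. -/

section Flows

variable {G : Type*} [Group G] [TopologicalSpace G] {a : Multiplicative ℝ →* G}

theorem isClosedEmbedding_comp_ofAdd (ha : Topology.IsClosedEmbedding a) :
    Topology.IsClosedEmbedding fun t : ℝ => a (Multiplicative.ofAdd t) :=
  ha.comp (Homeomorph.mk Multiplicative.ofAdd continuous_ofAdd
    continuous_toAdd).isClosedEmbedding

variable [IsTopologicalGroup G]

/-- Left translation by a one-parameter subgroup. -/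
def leftTranslationFlow (a : Multiplicative ℝ →* G) (ha : Continuous a) : Flow ℝ G where
  toFun t x := a (Multiplicative.ofAdd t) * x
  cont' := (ha.comp (continuous_ofAdd.comp continuous_fst)).mul continuous_snd
  map_add' s t x := by simp [mul_assoc]
  map_zero' x := by simp

/-- Right translation by a one-parameter subgroup. -/
def rightTranslationFlow (a : Multiplicative ℝ →* G) (ha : Continuous a) : Flow ℝ G where
  toFun t x := x * a (Multiplicative.ofAdd t)
  cont' := continuous_snd.mul (ha.comp (continuous_ofAdd.comp continuous_fst))
  map_add' s t x := by rw [add_comm]; simp [mul_assoc]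
  map_zero' x := by simp

theorem leftTranslationFlow_apply (ha : Continuous a) (t : ℝ) (x : G) :
    leftTranslationFlow a ha t x = a (Multiplicative.ofAdd t) * x := rfl

theorem rightTranslationFlow_apply (ha : Continuous a) (t : ℝ) (x : G) :
    rightTranslationFlow a ha t x = x * a (Multiplicative.ofAdd t) := rfl

theorem isProperFlow_leftTranslationFlow (ha : Topology.IsClosedEmbedding a) :
    (leftTranslationFlow a ha.continuous).IsProperFlow := fun K L hK hL =>
  ⟨_, (isClosedEmbedding_comp_ofAdd ha).isCompact_preimage (hL.mul hK.inv), fun x hx t ht =>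
    Set.mem_mul.2 ⟨_, ht, x⁻¹, Set.inv_mem_inv.2 hx, by
      simp [leftTranslationFlow_apply]⟩⟩

theorem isProperFlow_rightTranslationFlow (ha : Topology.IsClosedEmbedding a) :
    (rightTranslationFlow a ha.continuous).IsProperFlow := fun K L hK hL =>
  ⟨_, (isClosedEmbedding_comp_ofAdd ha).isCompact_preimage (hK.inv.mul hL), fun x hx t ht =>
    Set.mem_mul.2 ⟨x⁻¹, Set.inv_mem_inv.2 hx, _, ht, by
      simp [rightTranslationFlow_apply]⟩⟩

/-- If the range of a closed one-parameter subgroup is normal, then the orbit integrals for right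
translations are nonzero multiples of those for left translations. -/
theorem orbitIntegral_rightTranslationFlow_ne_zero (ha : Topology.IsClosedEmbedding a)
    (hn : a.range.Normal) {f : G → ℂ}
    (hf : (leftTranslationFlow a ha.continuous).orbitIntegral f ≠ 0) :
    (rightTranslationFlow a ha.continuous).orbitIntegral f ≠ 0 := by
  contrapose! hf
  funext x
  -- Conjugation by `x⁻¹` induces a continuous additive map `c` of `ℝ`, hence multiplication by `c
  -- 1`, which is nonzero by injectivity.
  have hmem (t : ℝ) : ∃ s : ℝ, a (Multiplicative.ofAdd s)
      = x⁻¹ * a (Multiplicative.ofAdd t) * x := by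
    obtain ⟨s, hs⟩ := hn.conj_mem _ ⟨Multiplicative.ofAdd t, rfl⟩ x⁻¹
    exact ⟨s.toAdd, by simpa using hs⟩
  choose c hc using hmem
  have hemb := isClosedEmbedding_comp_ofAdd ha
  have hcont : Continuous c := by
    rw [hemb.isInducing.continuous_iff]
    have : Continuous fun t => x⁻¹ * a (Multiplicative.ofAdd t) * x :=
      (continuous_const.mul hemb.continuous).mul continuous_const
    exact this.congr fun t => (hc t).symm
  let cl : ℝ →+ ℝ := AddMonoidHom.mk' c fun s t => hemb.injective (by
    simp only [ofAdd_add, map_mul, hc]; group)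
  have hlin (t : ℝ) : c t = c 1 * t := by
    have := map_real_smul cl hcont t 1
    simpa [cl, mul_comm] using this
  have hc1 : c 1 ≠ 0 := fun h => by
    have h1 := hc 1
    rw [h] at h1
    have h2 : a (Multiplicative.ofAdd 1) = a (Multiplicative.ofAdd 0) := by
      rw [ofAdd_zero, map_one a, eq_comm, mul_assoc, inv_mul_eq_one] at h1
      rw [ofAdd_zero, map_one a]
      exact mul_eq_right.1 h1.symm
    exact one_ne_zero (hemb.injective h2)
  have hx : (leftTranslationFlow a ha.continuous).orbitIntegral f x
      = ∫ t, (fun s => f (x * a (Multiplicative.ofAdd s))) (c 1 * t) := by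
    refine integral_congr_ae (Filter.Eventually.of_forall fun t => ?_)
    simp only [leftTranslationFlow_apply, ← hlin, hc]
    congr 1
    group
  rw [hx, Measure.integral_comp_mul_left (fun s => f (x * a (Multiplicative.ofAdd s)))]
  have := congrFun hf x
  simp only [Flow.orbitIntegral, rightTranslationFlow_apply, Pi.zero_apply] at this
  simp [this]

end Flows

/-! ### Annihilators are stable under integrated translations. -/

section Convolution

open scoped Pointwise

variable {G : Type*} [Group G] [TopologicalSpace G] [IsTopologicalGroup G]
  [MeasurableSpace G] [BorelSpace G]
  {a : Multiplicative ℝ →* G} (μ : Measure G) [μ.IsHaarMeasure] {f g : G → ℂ}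

/-- Translating `f` on the left translates `f * g`, by invariance of `μ`; Fubini then integrates
over the translations. -/
theorem groupConvolution_leftTranslation_primitive [R1Space G]
    (ha : Topology.IsClosedEmbedding a)
    (hf : Continuous f) (hfs : HasCompactSupport f) (hg : Continuous g)
    (hgs : HasCompactSupport g) (h : groupConvolution μ f g = 0) :
    groupConvolution μ ((leftTranslationFlow a ha.continuous).primitive f) g = 0 := by
  funext x
  have hL : IsCompact ({x} * (tsupport g)⁻¹) := isCompact_singleton.mul hgs.isCompact.inv
  obtain ⟨T, hT, hT'⟩ := isProperFlow_leftTranslationFlow ha _ _ hL hfs.isCompact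
  have ht (t : ℝ) : ∫ y, f (a (Multiplicative.ofAdd t) * y) * g (y⁻¹ * x) ∂μ = 0 := by
    have := congrFun h (a (Multiplicative.ofAdd t) * x)
    rw [groupConvolution, ← integral_mul_left_eq_self _ (a (Multiplicative.ofAdd t))] at this
    simpa [mul_assoc] using this
  simp only [groupConvolution, Flow.primitive, leftTranslationFlow_apply, ← integral_mul_const]
  rw [integral_integral_swap_of_hasCompactSupport
    (f := fun y t => f (a (Multiplicative.ofAdd t) * y) * g (y⁻¹ * x))]
  · simp [ht]
  · have hc := (isClosedEmbedding_comp_ofAdd ha).continuous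
    exact (hf.comp ((hc.comp continuous_snd).mul continuous_fst)).mul
      (hg.comp (continuous_fst.inv.mul continuous_const))
  · refine HasCompactSupport.intro (hL.prod hT) fun p hp => ?_
    by_contra h0
    obtain ⟨h1, h2⟩ := mul_ne_zero_iff.1 h0
    have hy : p.1 ∈ ({x} * (tsupport g)⁻¹ : Set G) :=
      Set.mem_mul.2 ⟨x, rfl, x⁻¹ * p.1, by
        simpa using subset_tsupport g h2, by simp⟩
    exact hp ⟨hy, hT' _ hy _ (subset_tsupport f h1)⟩

/-- The measure `ν` is left free to cover both primitives (Lebesgue measure on `Iic 0`) and fibre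
integrals (all of `ℝ`). -/
theorem groupConvolution_integral_rightTranslation [R1Space G]
    (ha : Topology.IsClosedEmbedding a) (ν : Measure ℝ) [IsFiniteMeasureOnCompacts ν]
    (hf : Continuous f) (hfs : HasCompactSupport f) (hg : Continuous g)
    (hgs : HasCompactSupport g) (h : groupConvolution μ f g = 0) :
    groupConvolution μ f (fun x => ∫ t, g (rightTranslationFlow a ha.continuous t x) ∂ν) = 0 := by
  funext x
  have hL : IsCompact ((tsupport f)⁻¹ * {x}) := hfs.isCompact.inv.mul isCompact_singleton
  obtain ⟨T, hT, hT'⟩ := isProperFlow_rightTranslationFlow ha _ _ hL hgs.isCompact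
  have ht (t : ℝ) : ∫ y, f y * g (y⁻¹ * x * a (Multiplicative.ofAdd t)) ∂μ = 0 := by
    have := congrFun h (x * a (Multiplicative.ofAdd t))
    simpa [groupConvolution, mul_assoc] using this
  simp only [groupConvolution, rightTranslationFlow_apply, ← integral_const_mul]
  rw [integral_integral_swap_of_hasCompactSupport
    (f := fun y t => f y * g (y⁻¹ * x * a (Multiplicative.ofAdd t)))]
  · simp [ht]
  · have hc := (isClosedEmbedding_comp_ofAdd ha).continuous
    exact (hf.comp continuous_fst).mul
      (hg.comp ((continuous_fst.inv.mul continuous_const).mul (hc.comp continuous_snd)))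
  · refine HasCompactSupport.intro (hfs.isCompact.prod hT) fun p hp => ?_
    by_contra h0
    obtain ⟨h1, h2⟩ := mul_ne_zero_iff.1 h0
    have hy : p.1 ∈ tsupport f := subset_tsupport f h1
    exact hp ⟨hy, hT' _ (Set.mul_mem_mul (Set.inv_mem_inv.2 hy) rfl) _ (subset_tsupport g h2)⟩

end Convolution

/-! ### Integration over the total group through fibres. -/

namespace TopologicalGroup.IsSES

variable {A B C : Type*} [Group A] [Group B] [Group C]
  [TopologicalSpace A] [TopologicalSpace B] [TopologicalSpace C]
  {φ : A →* B} {ψ : B →* C} (H : TopologicalGroup.IsSES φ ψ)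
  [IsTopologicalGroup A] [IsTopologicalGroup B] [IsTopologicalGroup C]
  [LocallyCompactSpace B] [T2Space B]
  [MeasurableSpace A] [BorelSpace A] [MeasurableSpace B] [BorelSpace B]
  [MeasurableSpace C] [BorelSpace C]
  (μA : Measure A) [μA.IsHaarMeasure] (μC : Measure C) [μC.IsHaarMeasure]
  (μB : Measure B) [μB.IsHaarMeasure]

/-- Iterated integration defines a left-invariant measure on `B`, so uniqueness of Haar measure
applies. -/
theorem integral_pushforward_real (f : C_c(B, ℝ)) :
    ∫ c, H.pushforward μA f c ∂μC
      = (Measure.haarScalarFactor (H.inducedMeasure μA μC) μB : ℝ) * ∫ b, f b ∂μB := by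
  rw [← integrate_apply, ← integral_inducedMeasure,
    Measure.integral_isMulLeftInvariant_eq_smul_of_hasCompactSupport _ μB (f := f) f.continuous
      f.hasCompactSupport, integral_smul_nnreal_measure]
  rfl

theorem integral_pushforward_eq_zero (f : C_c(B, ℂ)) (hf : ∫ b, f b ∂μB = 0) :
    ∫ c, H.pushforward μA f c ∂μC = 0 := by
  have key (L : ℂ →L[ℝ] ℝ) : L (∫ c, H.pushforward μA f c ∂μC) = 0 := by
    let g : C_c(B, ℝ) := ⟨⟨fun b => L (f b), L.continuous.comp f.continuous⟩,
      f.hasCompactSupport.comp_left (map_zero L)⟩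
    have hg (c : C) : L (H.pushforward μA f c) = H.pushforward μA g c := by
      obtain ⟨b, rfl⟩ := H.isOpenQuotientMap.surjective c
      rw [pushforward_apply_apply, pushforward_apply_apply,
        ← L.integral_comp_comm (H.pullback f b).integrable]
      rfl
    rw [← L.integral_comp_comm (H.pushforward μA f).integrable]
    simp_rw [hg]
    rw [H.integral_pushforward_real μA μC μB]
    have : ∫ b, g b ∂μB = L (∫ b, f b ∂μB) := L.integral_comp_comm f.integrable
    rw [this, hf]
    simp
  exact Complex.ext (key Complex.reCLM) (key Complex.imCLM)

end TopologicalGroup.IsSES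

instance : MeasurableSpace (Multiplicative ℝ) := inferInstanceAs (MeasurableSpace ℝ)

instance : BorelSpace (Multiplicative ℝ) :=
  ⟨(BorelSpace.measurable_eq : (inferInstance : MeasurableSpace ℝ) = borel ℝ)⟩

/-- Lebesgue measure on the multiplicative copy of the real line. -/
noncomputable def multiplicativeRealVolume : Measure (Multiplicative ℝ) :=
  (volume : Measure ℝ)

instance : multiplicativeRealVolume.IsHaarMeasure where
  lt_top_of_isCompact _ hK := IsCompact.measure_lt_top (μ := (volume : Measure ℝ)) hK
  map_mul_left_eq_self t := map_add_left_eq_self (volume : Measure ℝ) t.toAdd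
  open_pos U hU hne := IsOpen.measure_ne_zero (volume : Measure ℝ) (U := U) hU hne

theorem integral_multiplicativeRealVolume (f : Multiplicative ℝ → ℂ) :
    ∫ s, f s ∂multiplicativeRealVolume = ∫ t : ℝ, f (Multiplicative.ofAdd t) := rfl

/-! ### Descent to the quotient. -/

section Extension

variable {G Q : Type*} [Group G] [TopologicalSpace G] [IsTopologicalGroup G]
  [LocallyCompactSpace G] [Group Q] [TopologicalSpace Q] [IsTopologicalGroup Q]
  {a : Multiplicative ℝ →* G} {p : G →* Q}

theorem pushforward_multiplicativeRealVolume_apply (H : TopologicalGroup.IsSES a p) (f : C_c(G, ℂ))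
    (x : G) : H.pushforward multiplicativeRealVolume f (p x)
      = (rightTranslationFlow a H.isClosedEmbedding.continuous).orbitIntegral f x := by
  rw [TopologicalGroup.IsSES.pushforward_apply_apply, integral_multiplicativeRealVolume]
  rfl

variable [T2Space G] [MeasurableSpace G] [BorelSpace G] [MeasurableSpace Q] [BorelSpace Q]

/-- Fibre integration is compatible with vanishing of convolutions. -/
theorem groupConvolution_pushforward_eq_zero (muG : Measure G) [muG.IsHaarMeasure]
    (muQ : Measure Q) [muQ.IsHaarMeasure] (H : TopologicalGroup.IsSES a p) {f g : C_c(G, ℂ)}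
    (h : groupConvolution muG f g = 0) :
    groupConvolution muQ (H.pushforward multiplicativeRealVolume f)
      (H.pushforward multiplicativeRealVolume g) = 0 := by
  funext z'
  obtain ⟨z, rfl⟩ := H.isOpenQuotientMap.surjective z'
  set g' := H.pushforward multiplicativeRealVolume g
  have hp := H.isOpenQuotientMap.continuous
  -- The second factor is constant on fibres, so the fibre integrals of `k` form the integrand of
  -- the convolution on `Q` at `p z`.
  let k : C_c(G, ℂ) := ⟨⟨fun y => f y * g' ((p y)⁻¹ * p z), f.continuous.mul
    (g'.continuous.comp (hp.inv.mul continuous_const))⟩, f.hasCompactSupport.mul_right⟩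
  have hk : ∫ y, k y ∂muG = 0 := by
    have := congrFun (groupConvolution_integral_rightTranslation muG H.isClosedEmbedding volume
      f.continuous f.hasCompactSupport g.continuous g.hasCompactSupport h) z
    refine Eq.trans (integral_congr_ae (Filter.Eventually.of_forall fun y => ?_)) this
    change f y * g' ((p y)⁻¹ * p z) = _
    rw [← map_inv, ← map_mul, pushforward_multiplicativeRealVolume_apply]
    rfl
  refine Eq.trans (integral_congr_ae (Filter.Eventually.of_forall fun q => ?_))
    (H.integral_pushforward_eq_zero multiplicativeRealVolume muQ muG k hk)
  obtain ⟨y, rfl⟩ := H.isOpenQuotientMap.surjective q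
  simp only [pushforward_multiplicativeRealVolume_apply, Flow.orbitIntegral,
    rightTranslationFlow_apply]
  rw [← integral_mul_const]
  refine integral_congr_ae (Filter.Eventually.of_forall fun t => ?_)
  change _ = f (y * a _) * g' ((p (y * a _))⁻¹ * p z)
  rw [map_mul p, H.mulExact.apply_apply_eq_one, mul_one]

/-- For an extension of locally compact groups by the real line, absence of zero divisors in the
convolution algebra passes from the quotient to the extension. -/
theorem CcHasNoZeroDivisors.of_isSES (muG : Measure G) [muG.IsHaarMeasure]
    (muQ : Measure Q) [muQ.IsHaarMeasure] (H : TopologicalGroup.IsSES a p)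
    (hQ : CcHasNoZeroDivisors Q muQ) : CcHasNoZeroDivisors G muG := by
  intro f g hfg
  have ha := H.isClosedEmbedding
  have hnormal : a.range.Normal := by
    rw [← H.mulExact.monoidHom_ker_eq]
    infer_instance
  by_contra! hne
  obtain ⟨hf, hg⟩ := hne
  set φl := leftTranslationFlow a ha.continuous
  set φr := rightTranslationFlow a ha.continuous
  have hl : φl.IsProperFlow := isProperFlow_leftTranslationFlow ha
  have hr : φr.IsProperFlow := isProperFlow_rightTranslationFlow ha
  obtain ⟨F, hFc, hFs, hF, hF0⟩ : ∃ F : G → ℂ, Continuous F ∧ HasCompactSupport F ∧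
      groupConvolution muG F g = 0 ∧ φl.orbitIntegral F ≠ 0 := by
    by_contra! hall
    refine hf (DFunLike.coe_injective ?_)
    refine hl.eq_zero_of_forall_orbitIntegral_eq_zero (P := fun F => Continuous F ∧
      HasCompactSupport F ∧ groupConvolution muG F g = 0) (fun F ⟨hFc, hFs, hF⟩ => ?_)
      ⟨f.continuous, f.hasCompactSupport, hfg⟩
    have h0 := hall F hFc hFs hF
    exact ⟨hFc, hFs, h0, hl.continuous_primitive hFc hFs, hl.hasCompactSupport_primitive hFs h0,
      groupConvolution_leftTranslation_primitive muG ha hFc hFs g.continuous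
        g.hasCompactSupport hF⟩
  obtain ⟨K, hKc, hKs, hK, hK0⟩ : ∃ K : G → ℂ, Continuous K ∧ HasCompactSupport K ∧
      groupConvolution muG F K = 0 ∧ φr.orbitIntegral K ≠ 0 := by
    by_contra! hall
    refine hg (DFunLike.coe_injective ?_)
    refine hr.eq_zero_of_forall_orbitIntegral_eq_zero (P := fun K => Continuous K ∧
      HasCompactSupport K ∧ groupConvolution muG F K = 0) (fun K ⟨hKc, hKs, hK⟩ => ?_)
      ⟨g.continuous, g.hasCompactSupport, hF⟩
    have h0 := hall K hKc hKs hK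
    exact ⟨hKc, hKs, h0, hr.continuous_primitive hKc hKs, hr.hasCompactSupport_primitive hKs h0,
      groupConvolution_integral_rightTranslation muG ha _ hFc hFs hKc hKs hK⟩
  -- `F` was chosen by left orbits, whereas the pushforward integrates over right ones.
  have hF0' := orbitIntegral_rightTranslationFlow_ne_zero ha hnormal hF0
  have hpush {f : C_c(G, ℂ)} (h : H.pushforward multiplicativeRealVolume f = 0) :
      φr.orbitIntegral f = 0 := by
    funext x
    rw [← pushforward_multiplicativeRealVolume_apply H, h]
    rfl
  rcases hQ _ _ (groupConvolution_pushforward_eq_zero muG muQ H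
    (f := ⟨⟨F, hFc⟩, hFs⟩) (g := ⟨⟨K, hKc⟩, hKs⟩) hK) with h | h
  · exact hF0' (hpush h)
  · exact hK0 (hpush h)

end Extension

theorem mainTheorem2
    {EA EG EQ : Type*}
    [NormedAddCommGroup EA] [NormedSpace ℝ EA] [FiniteDimensional ℝ EA]
    [NormedAddCommGroup EG] [NormedSpace ℝ EG] [FiniteDimensional ℝ EG]
    [NormedAddCommGroup EQ] [NormedSpace ℝ EQ] [FiniteDimensional ℝ EQ]
    {A G Q : Type*}
    [Group A] [TopologicalSpace A] [ChartedSpace EA A] [LieGroup 𝓘(ℝ, EA) ∞ A]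
    [Group G] [TopologicalSpace G] [ChartedSpace EG G] [LieGroup 𝓘(ℝ, EG) ∞ G]
    [Group Q] [TopologicalSpace Q] [ChartedSpace EQ Q] [LieGroup 𝓘(ℝ, EQ) ∞ Q]
    [MeasurableSpace G] [BorelSpace G] [MeasurableSpace Q] [BorelSpace Q]
    (muG : Measure G) [muG.IsHaarMeasure]
    (muQ : Measure Q) [muQ.IsHaarMeasure]
    (S : GroupExtension A G Q) (hS : IsLieGroupExtension EA EG EQ S)
    (hA : Nonempty (A ≃ₜ* Multiplicative ℝ))
    (hQ : CcHasNoZeroDivisors Q muQ) :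
    CcHasNoZeroDivisors G muG := by
  obtain ⟨e⟩ := hA
  have : IsTopologicalGroup G := topologicalGroup_of_lieGroup 𝓘(ℝ, EG) ∞
  have : IsTopologicalGroup Q := topologicalGroup_of_lieGroup 𝓘(ℝ, EQ) ∞
  have : LocallyCompactSpace G := Manifold.locallyCompact_of_finiteDimensional 𝓘(ℝ, EG)
  -- Charts give only T1; the group structure upgrades `G` to Hausdorff, and T1 for `Q` makes the
  -- kernel closed.
  have : T1Space G := ChartedSpace.t1Space EG G
  have : T1Space Q := ChartedSpace.t1Space EQ Q
  have hrange : Set.range S.inl = S.rightHom ⁻¹' {1} := by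
    have := congrArg (fun H : Subgroup G => (H : Set G)) S.range_inl_eq_ker_rightHom
    simpa [MonoidHom.coe_range, MonoidHom.coe_ker] using this
  have hclosed : Topology.IsClosedEmbedding S.inl :=
    ⟨hS.isEmbedding_inl, by
      rw [hrange]
      exact isClosed_singleton.preimage hS.isQuotientMap_rightHom.continuous⟩
  have H : TopologicalGroup.IsSES (S.inl.comp (e.symm : Multiplicative ℝ →* A)) S.rightHom :=
    { isClosedEmbedding := hclosed.comp e.symm.toHomeomorph.isClosedEmbedding
      isOpenQuotientMap := MonoidHom.isOpenQuotientMap_of_isQuotientMap hS.isQuotientMap_rightHom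
      mulExact := fun x => by
        have hx : x ∈ Set.range S.inl ↔ S.rightHom x = 1 := by rw [hrange]; rfl
        rw [← hx]
        constructor
        · rintro ⟨y, rfl⟩
          exact ⟨e y, by simp⟩
        · rintro ⟨y, rfl⟩
          exact ⟨_, rfl⟩ }
  exact CcHasNoZeroDivisors.of_isSES muG muQ H hQ
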